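/- Let $G$ be a group. A series of normal subgroups of $G$ $$G = G_1 > G_2 > \dots > G_n > G_{n+1} = 1 \qquad (n \ge 0)$$ with strict inclusions is called \emph{principal} if every factor $G_i/G_{i+1}$ ($1 \le i \le n$) is abelian and has no torsion as a $\mathbb{Z}[G/G_i]$-module, where $G/G_i$ acts on $G_i/G_{i+1}$ by conjugation; having no torsion means that $v\cdot u = 0$ with $v \in G_i/G_{i+1}$ and $u \in \mathbb{Z}[G/G_i]$ implies $v = 0$ or $u = 0$. A group is called \emph{rigid} if it has a principal series (in particular, the trivial group is rigid, with $n = 0$). **Proposition.** 1) Free solvable groups are rigid: for every set $X$ (finite or infinite) and every integer $c \ge 0$, the group $F/F^{(c)}$ is rigid, where $F$ is the free group with basis $X$ and $F^{(c)}$ is the $c$-th term of its derived series ($F^{(0)} = F$, $F^{(k+1)} = [F^{(k)},F^{(k)}]$). 2) If $A$ is a torsion-free abelian group and $B$ is a rigid group, then the restricted wreath product $A \wr B$ is rigid. Here $A \wr B$ is the semidirect product of $B$ with the group of finitely supported functions $B \to A$, on which $B$ acts by translations. -/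

import Mathlib

namespace RigidGroup

section Factor

variable {G : Type*} [Group G] (N M : Subgroup G)

/-- The factor `N / M` of two subgroups `M ≤ N` of `G` (more generally `N / (M ∩ N)`). -/
abbrev Factor : Type _ := N ⧸ M.subgroupOf N

/-- Conjugation by `g`, as an automorphism of the factor `N / M` of normal subgroups:
`x M ↦ g x g⁻¹ M`. -/
noncomputable def conjFactor [N.Normal] [M.Normal] : G →* MulAut (Factor N M) where
  toFun g := QuotientGroup.congr (M.subgroupOf N) (M.subgroupOf N) (MulAut.conjNormal g) (by
    ext x
    constructor
    · rintro ⟨y, hy, rfl⟩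
      exact ‹M.Normal›.conj_mem _ hy g
    · intro hx
      refine ⟨(MulAut.conjNormal g).symm x, ?_, by simp⟩
      have := ‹M.Normal›.conj_mem _ (Subgroup.mem_subgroupOf.1 hx) g⁻¹
      simpa [Subgroup.mem_subgroupOf] using this)
  map_one' := by
    ext x
    induction x using QuotientGroup.induction_on
    simp
  map_mul' g h := by
    ext x
    induction x using QuotientGroup.induction_on
    simp

variable {N M}

/-- The structure of a commutative group on an abelian factor. -/
@[reducible] noncomputable def factorCommGroup [M.Normal] (hab : IsMulCommutative (Factor N M)) :
    CommGroup (Factor N M) :=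
  { (inferInstance : Group (Factor N M)) with mul_comm := hab.is_comm.comm }

/-- If the factor `N / M` is abelian, then `N` acts trivially on it, so that the conjugation
action of `G` on `N / M` induces an action of `G / N`. -/
noncomputable def quotientConj [N.Normal] [M.Normal] (hab : IsMulCommutative (Factor N M)) :
    G ⧸ N →* MulAut (Factor N M) :=
  QuotientGroup.lift N (conjFactor N M) (by
    intro g hg
    ext x
    induction x using QuotientGroup.induction_on with
    | H x =>
      have h := hab.is_comm.comm (QuotientGroup.mk (⟨g, hg⟩ : N) : Factor N M)
        (QuotientGroup.mk x)
      have h2 : conjFactor N M g (QuotientGroup.mk x) =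
          (QuotientGroup.mk (⟨g, hg⟩ : N) : Factor N M) * QuotientGroup.mk x *
            (QuotientGroup.mk (⟨g, hg⟩ : N) : Factor N M)⁻¹ := rfl
      rw [h2, h]
      simp)

/-- The abelian factor `N / M`, written additively, as an integral representation of `G / N`
by conjugation; the corresponding module over the group ring `ℤ[G / N]` is
`(factorRep hab).asModule`. -/
noncomputable def factorRep [N.Normal] [M.Normal] (hab : IsMulCommutative (Factor N M)) :
    letI := factorCommGroup hab
    Representation ℤ (G ⧸ N) (Additive (Factor N M)) :=
  letI := factorCommGroup hab
  { toFun := fun b => (MonoidHom.toAdditive (quotientConj hab b).toMonoidHom).toIntLinearMap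
    map_one' := by
      ext x
      simp
    map_mul' := fun b c => by
      ext x
      simp }

/-- The abelian factor `N / M` has no torsion as a module over the group ring `ℤ[G / N]`, on which
`G / N` acts by conjugation. -/
def FactorTorsionFree [N.Normal] [M.Normal] (hab : IsMulCommutative (Factor N M)) : Prop :=
  letI := factorCommGroup hab
  ∀ (r : MonoidAlgebra ℤ (G ⧸ N)) (v : (factorRep hab).asModule), r • v = 0 → r = 0 ∨ v = 0

end Factor

/-- A principal series `G = H 0 > H 1 > ... > H n = 1` of a group `G`: the `H i` are normal in `G`,
and each factor `H i / H (i + 1)` is abelian and has no torsion as a module over the group ring of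
`G / H i`. The trivial group has such a series of length `n = 0`. -/
structure IsPrincipalSeries {G : Type*} [Group G] {n : ℕ} (H : Fin (n + 1) → Subgroup G) :
    Prop where
  normal : ∀ i, (H i).Normal
  first : H 0 = ⊤
  last : H (Fin.last n) = ⊥
  strictAnti : StrictAnti H
  abelian : ∀ i : Fin n,
    haveI := normal i.succ
    IsMulCommutative (Factor (H i.castSucc) (H i.succ))
  torsionFree : ∀ i : Fin n,
    haveI := normal i.castSucc
    haveI := normal i.succ
    FactorTorsionFree (abelian i)

/-- A group is rigid if it has a principal series. -/
def IsRigid (G : Type*) [Group G] : Prop :=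
  ∃ (n : ℕ) (H : Fin (n + 1) → Subgroup G), IsPrincipalSeries H

/-- The free solvable group of class `c` with basis `X`: the quotient of the free group on `X` by
the `c`-th term of its derived series. -/
abbrev FreeSolvableGroup (X : Type*) (c : ℕ) : Type _ :=
  FreeGroup X ⧸ derivedSeries (FreeGroup X) c

/-- The (restricted) wreath product `A ≀ B`: the elements `(f, b)` of the unrestricted regular
wreath product for which `f : B → A` has finite support. -/
def WreathProduct (A B : Type*) [Group A] [Group B] : Subgroup (RegularWreathProduct A B) where
  carrier := {w | (Function.mulSupport w.left).Finite}
  one_mem' := by simp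
  mul_mem' := by
    intro a b ha hb
    have hb' : (Function.mulSupport fun x => b.left (a.right⁻¹ * x)).Finite :=
      Set.Finite.preimage (f := fun x => a.right⁻¹ * x) (mul_right_injective _).injOn hb
    exact (ha.union hb').subset (Function.mulSupport_mul _ _)
  inv_mem' := by
    intro a ha
    have ha' : (Function.mulSupport fun x => a.left (a.right * x)).Finite :=
      Set.Finite.preimage (f := fun x => a.right * x) (mul_right_injective _).injOn ha
    refine ha'.subset ?_
    intro x hx
    simpa using hx

end RigidGroup

/-!
Both parts rest on one criterion, `IsRigid.of_injective_wreathProduct`: if `A` is a torsion-free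
abelian group and `B` is rigid, then every group `G` that embeds into `A ≀ B` in such a way that it
projects onto `B` is rigid. The wreath product itself is the case `G = A ≀ B`.

For the criterion, pull a principal series of `B` back to `G`. The factors of the pulled back
series embed equivariantly into those of the given one, so they have no torsion
(`FactorTorsionFree.comap`). What remains is the kernel of the projection, which embeds into the
`ℤ[B]`-module of finitely supported functions `B → A`. The factors of a principal series are
torsion-free abelian groups, since nonzero integers are among the scalars; such groups have unique
products, because they embed into vector spaces over `ℚ`, and the property passes to extensions.
Hence `B` has unique products (`IsRigid.uniqueProds`). If `r` is a nonzero element of `ℤ[B]` and `v`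
a nonzero function of finite support, then the value of `r • v` at a product that is unique among
those of their supports is a single term, which is not trivial as `A` is torsion-free
(`translationRep_eq_zero`).

Free solvable groups are treated by induction on the class, the step being that rigidity of `F / R`
implies rigidity of `F / [R, R]` for a normal subgroup `R` of the free group `F` on `X`. Here the
criterion is applied to the Magnus homomorphism from `F` to the wreath product of the free abelian
group on `X` with `F / R`, whose kernel is `[R, R]` (`ker_magnus`). To see that an element `w` of the
kernel lies in `[R, R]`, choose representatives `σ b` of the elements `b` of `F / R`. The Magnus
image of `w` records how often each edge of the Cayley graph of `F / R` is traversed by the path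
labelled `w`. Sending the edge at `b` labelled `x` to the class of `σ b * x * (σ (b * x))⁻¹` in the
abelianization of `R` recovers the class of `σ 1 * w * (σ 1)⁻¹` from that image
(`of_schreier_eq_finprod`).
-/

namespace RigidGroup

/-! ### Groups with unique products -/

/-- Torsion-free abelian groups embed into vector spaces over `ℚ`, which have unique sums. -/
theorem uniqueProds_of_isMulTorsionFree (A : Type*) [CommGroup A] [IsMulTorsionFree A] :
    UniqueProds A := by
  have : UniqueSums (Additive A) :=
    UniqueSums.of_injective_addHom (DivisibleHull.coeAddMonoidHom (M := Additive A)).toAddHom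
      DivisibleHull.coe_injective inferInstance
  exact (MulEquiv.multiplicativeAdditive A).uniqueProds_iff.1 inferInstance

/-- An extension of a group with unique products by a group with unique products has unique
products. -/
theorem uniqueProds_of_ker {G H : Type*} [Group G] [Group H] (f : G →* H) [UniqueProds H]
    [UniqueProds f.ker] : UniqueProds G := by
  classical
  refine ⟨fun {A B} hA hB => ?_⟩
  obtain ⟨aH, haH, bH, hbH, hu⟩ :=
    UniqueProds.uniqueMul_of_nonempty (hA.image f) (hB.image f)
  obtain ⟨a₀, ha₀, rfl⟩ := Finset.mem_image.1 haH
  obtain ⟨b₀, hb₀, rfl⟩ := Finset.mem_image.1 hbH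
  -- The parts of `A` and `B` over the unique pair, translated into the kernel from the outside.
  let A' : Finset f.ker := A.preimage (fun k => a₀ * (k : G))
    (fun x _ y _ h => Subtype.ext (mul_left_cancel h))
  let B' : Finset f.ker := B.preimage (fun k => (k : G) * b₀)
    (fun x _ y _ h => Subtype.ext (mul_right_cancel h))
  have memA' (k : f.ker) : k ∈ A' ↔ a₀ * k ∈ A := Finset.mem_preimage
  have memB' (k : f.ker) : k ∈ B' ↔ k * b₀ ∈ B := Finset.mem_preimage
  have hA' : A'.Nonempty := ⟨1, (memA' 1).2 (by simpa using ha₀)⟩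
  have hB' : B'.Nonempty := ⟨1, (memB' 1).2 (by simpa using hb₀)⟩
  obtain ⟨k, hk, l, hl, hkl⟩ := UniqueProds.uniqueMul_of_nonempty hA' hB'
  have hfk : f k = 1 := k.2
  have hfl : f l = 1 := l.2
  refine ⟨a₀ * k, (memA' k).1 hk, l * b₀, (memB' l).1 hl,
    UniqueMul.of_image_filter (f : G →ₙ* H) (aH := f a₀) (bH := f b₀) ?_ ?_ hu ?_⟩
  · simp [hfk]
  · simp [hfl]
  · intro a b ha hb hab
    obtain ⟨haA, hfa : f a = f a₀⟩ := Finset.mem_filter.1 ha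
    obtain ⟨hbB, hfb : f b = f b₀⟩ := Finset.mem_filter.1 hb
    let a' : f.ker := ⟨a₀⁻¹ * a, by simp [MonoidHom.mem_ker, hfa]⟩
    let b' : f.ker := ⟨b * b₀⁻¹, by simp [MonoidHom.mem_ker, hfb]⟩
    have hab' : a' * b' = k * l := by
      ext
      have : a₀⁻¹ * (a * b) * b₀⁻¹ = a₀⁻¹ * (a₀ * k * (l * b₀)) * b₀⁻¹ := by rw [hab]
      simpa [a', b', mul_assoc] using this
    have h := hkl ((memA' a').2 (by simpa [a'] using haA))
      ((memB' b').2 (by simpa [b'] using hbB)) hab'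
    constructor
    · rw [← h.1]; simp [a']
    · rw [← h.2]; simp [b']

/-! ### Factors without torsion -/

section Factor

variable {G : Type*} [Group G] {N M : Subgroup G}

/-- The factor `N / M` has no torsion as soon as it embeds, equivariantly along an injective
homomorphism `θ` of the acting groups, into a representation in which no nonzero element of the
group ring annihilates a nonzero element of the image. -/
theorem FactorTorsionFree.of_injective [N.Normal] [M.Normal] (hab : IsMulCommutative (Factor N M))
    {Q T : Type*} [Group Q] [CommGroup T] (ρ : Representation ℤ Q (Additive T)) (θ : G ⧸ N →* Q)
    (hθ : Function.Injective θ) (k : Factor N M →* T) (hk : Function.Injective k)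
    (hkθ : ∀ (g : G) (x : N), .ofMul (k (conjFactor N M g x)) = ρ (θ g) (.ofMul (k x)))
    (hρ : ∀ (r : MonoidAlgebra ℤ Q) (x : Factor N M),
      ρ.asAlgebraHom r (.ofMul (k x)) = 0 → r = 0 ∨ k x = 1) :
    FactorTorsionFree hab := by
  let := factorCommGroup hab
  intro r v hrv
  let k' : Additive (Factor N M) →+ Additive T := MonoidHom.toAdditive k
  have hkθ' : ∀ (g : G ⧸ N) (x : Additive (Factor N M)),
      k' (factorRep hab g x) = ρ (θ g) (k' x) := by
    intro g x
    induction g using QuotientGroup.induction_on with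
    | H g =>
      obtain ⟨y, hy⟩ := QuotientGroup.mk_surjective (Additive.toMul x)
      obtain rfl : x = .ofMul (y : Factor N M) := congrArg Additive.ofMul hy.symm
      exact hkθ g y
  have key : ∀ (r : MonoidAlgebra ℤ (G ⧸ N)) (v : Additive (Factor N M)),
      k' ((factorRep hab).asAlgebraHom r v) =
        ρ.asAlgebraHom (MonoidAlgebra.mapDomain θ r) (k' v) := by
    intro r v
    induction r using MonoidAlgebra.induction_linear with
    | zero => simp
    | add a b ha hb => simp [ha, hb, MonoidAlgebra.mapDomain_add]
    | single g n => simp [hkθ']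
  have h0 : (factorRep hab).asAlgebraHom r ((factorRep hab).asModuleEquiv v) = 0 := by
    rw [← Representation.asModuleEquiv_map_smul, hrv, map_zero]
  have h1 := key r ((factorRep hab).asModuleEquiv v)
  rw [h0, map_zero] at h1
  rcases hρ _ _ h1.symm with h | h
  · left
    apply MonoidAlgebra.mapDomain_injective hθ
    rw [h, MonoidAlgebra.mapDomain_zero]
  · right
    exact hk (h.trans (map_one k).symm)

theorem isMulCommutative_factor_of_injective {T : Type*} [Group T] [M.Normal]
    (hT : IsMulCommutative T) (k : Factor N M →* T) (hk : Function.Injective k) :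
    IsMulCommutative (Factor N M) :=
  ⟨⟨fun x y => hk (by rw [map_mul, map_mul, hT.is_comm.comm])⟩⟩

/-- The embedding of factors induced by a homomorphism `f`. -/
def factorComap {G' : Type*} [Group G'] (f : G →* G') (N' M' : Subgroup G') [M'.Normal] :
    Factor (N'.comap f) (M'.comap f) →* Factor N' M' :=
  QuotientGroup.map _ _ (f.subgroupComap N') (fun _ hx => hx)

theorem factorComap_injective {G' : Type*} [Group G'] (f : G →* G') (N' M' : Subgroup G')
    [M'.Normal] : Function.Injective (factorComap f N' M') := by
  rw [injective_iff_map_eq_one]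
  intro x hx
  induction x using QuotientGroup.induction_on with
  | H x =>
    exact (QuotientGroup.eq_one_iff _).2
      ((QuotientGroup.eq_one_iff (f.subgroupComap N' x)).1 hx)

/-- Absence of torsion passes to the factors of a preimage, whether or not `f` is surjective. -/
theorem FactorTorsionFree.comap {G' : Type*} [Group G'] (f : G →* G') {N' M' : Subgroup G'}
    [N'.Normal] [M'.Normal] {hab' : IsMulCommutative (Factor N' M')} (h : FactorTorsionFree hab')
    (hab : IsMulCommutative (Factor (N'.comap f) (M'.comap f))) :
    FactorTorsionFree hab := by
  let := factorCommGroup hab'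
  refine FactorTorsionFree.of_injective hab (T := Factor N' M') (factorRep hab')
    (QuotientGroup.map _ _ f le_rfl) ?_ (factorComap f N' M') (factorComap_injective f N' M')
    (fun g x => ?_) (fun r x hrx => h r _ hrx)
  · rw [injective_iff_map_eq_one]
    intro x hx
    induction x using QuotientGroup.induction_on with
    | H x => exact (QuotientGroup.eq_one_iff _).2 ((QuotientGroup.eq_one_iff (f x)).1 hx)
  · change Additive.ofMul ((f.subgroupComap N' (MulAut.conjNormal g x) : N') : Factor N' M') =
      Additive.ofMul ((MulAut.conjNormal (f g) (f.subgroupComap N' x) : N') : Factor N' M')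
    congr 2
    ext
    change f (g * x * g⁻¹) = f g * f x * (f g)⁻¹
    simp

/-- A torsion-free factor is a torsion-free group, as the nonzero integers are among the scalars. -/
theorem FactorTorsionFree.isMulTorsionFree [N.Normal] [M.Normal]
    {hab : IsMulCommutative (Factor N M)} (h : FactorTorsionFree hab) :
    IsMulTorsionFree (Factor N M) := by
  let := factorCommGroup hab
  have : IsMulTorsionFree (Factor N M) := by
    refine .of_not_isOfFinOrder fun x hx hfin => hx ?_
    obtain ⟨n, hn, hxn⟩ := isOfFinOrder_iff_pow_eq_one.1 hfin
    rcases h (MonoidAlgebra.single 1 (n : ℤ))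
      ((factorRep hab).asModuleEquiv.symm (Additive.ofMul x)) (by
      rw [Representation.single_smul, map_one, Nat.cast_smul_eq_nsmul]
      exact hxn) with h | h
    · rw [MonoidAlgebra.single_eq_zero] at h
      lia
    · exact h
  exact this

end Factor

/-! ### Principal series -/

/-- The condition that a principal series imposes on two consecutive terms `N ≥ M`. -/
def IsPrincipalFactor {G : Type*} [Group G] (N M : Subgroup G) : Prop :=
  ∃ (_ : N.Normal) (_ : M.Normal) (hab : IsMulCommutative (Factor N M)), FactorTorsionFree hab

theorem IsPrincipalSeries.isPrincipalFactor {G : Type*} [Group G] {n : ℕ}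
    {H : Fin (n + 1) → Subgroup G} (h : IsPrincipalSeries H) (i : Fin n) :
    IsPrincipalFactor (H i.castSucc) (H i.succ) :=
  ⟨h.normal _, h.normal _, h.abelian i, h.torsionFree i⟩

theorem IsPrincipalSeries.of_isPrincipalFactor {G : Type*} [Group G] {n : ℕ}
    {H : Fin (n + 1) → Subgroup G} (first : H 0 = ⊤) (last : H (Fin.last n) = ⊥)
    (lt : ∀ i : Fin n, H i.succ < H i.castSucc)
    (factor : ∀ i : Fin n, IsPrincipalFactor (H i.castSucc) (H i.succ)) :
    IsPrincipalSeries H where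
  normal i := by
    cases i using Fin.lastCases with
    | last => rw [last]; infer_instance
    | cast i => exact (factor i).1
  first := first
  last := last
  strictAnti := Fin.strictAnti_iff_succ_lt.2 lt
  abelian i := (factor i).2.2.1
  torsionFree i := (factor i).2.2.2

theorem IsPrincipalFactor.comap {G G' : Type*} [Group G] [Group G'] (f : G →* G')
    {N M : Subgroup G'} (h : IsPrincipalFactor N M) :
    IsPrincipalFactor (N.comap f) (M.comap f) := by
  obtain ⟨hN, hM, hab, htf⟩ := h
  exact ⟨inferInstance, inferInstance,
    isMulCommutative_factor_of_injective hab _ (factorComap_injective f N M), htf.comap f _⟩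

theorem IsPrincipalFactor.uniqueProds {G : Type*} [Group G] {N M : Subgroup G}
    (h : IsPrincipalFactor N M) [UniqueProds M] : UniqueProds N := by
  obtain ⟨hN, hM, hab, htf⟩ := h
  have : UniqueProds (Factor N M) := by
    let := factorCommGroup hab
    have : IsMulTorsionFree (Factor N M) := htf.isMulTorsionFree
    exact uniqueProds_of_isMulTorsionFree (Factor N M)
  let f : N →* Factor N M := QuotientGroup.mk' (M.subgroupOf N)
  have hf : ∀ x : f.ker, ((x : N) : G) ∈ M := fun x => (QuotientGroup.eq_one_iff (x : N)).1 x.2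
  have : UniqueProds f.ker :=
    UniqueProds.of_injective_mulHom
      ((N.subtype.comp f.ker.subtype).codRestrict M hf : f.ker →ₙ* M)
      (fun x y hxy => Subtype.ext (Subtype.ext (congrArg (fun m : M => (m : G)) hxy))) inferInstance
  exact uniqueProds_of_ker f

/-- Rigid groups have unique products, so their integral group rings have no zero divisors. -/
theorem IsRigid.uniqueProds {G : Type*} [Group G] (h : IsRigid G) : UniqueProds G := by
  obtain ⟨n, H, hH⟩ := h
  have key : ∀ i, UniqueProds (H i) := by
    intro i
    induction i using Fin.reverseInduction with
    | last =>
      have : Subsingleton (H (Fin.last n)) := by rw [hH.last]; infer_instance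
      exact ⟨fun hA hB => ⟨_, hA.choose_spec, _, hB.choose_spec, UniqueMul.of_subsingleton⟩⟩
    | cast i ih => exact (hH.isPrincipalFactor i).uniqueProds
  have h0 := key 0
  rw [hH.first] at h0
  exact Subgroup.topEquiv.uniqueProds_iff.1 h0

/-! ### Subgroups of wreath products -/

section Translation

variable (A B : Type*) [CommGroup A] [Group B]

/-- The functions `B → A`, written additively, as an integral representation of `B` by left
translations: `(b • v) x = v (b⁻¹ * x)`. -/
def translationRep : Representation ℤ B (Additive (B → A)) :=
  letI : MulDistribMulAction B (B → A) := arrowMulDistribMulAction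
  Representation.ofMulDistribMulAction B (B → A)

variable {A B}

theorem translationRep_apply (b x : B) (v : B → A) :
    (translationRep A B b (.ofMul v)).toMul x = v (b⁻¹ * x) := rfl

theorem translationRep_asAlgebraHom_apply (r : MonoidAlgebra ℤ B) (v : B → A) (x : B) :
    ((translationRep A B).asAlgebraHom r (.ofMul v)).toMul x =
      ∏ b ∈ r.coeff.support, v (b⁻¹ * x) ^ r.coeff b := by
  rw [Representation.asAlgebraHom_def, MonoidAlgebra.lift_apply, Finsupp.sum, LinearMap.sum_apply,
    toMul_sum, Finset.prod_apply]
  rfl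

/-- Over a group with unique products, the finitely supported functions with values in a
torsion-free group form a module without torsion: at a product that is unique among those of the
two supports, only one term contributes. -/
theorem translationRep_eq_zero [IsMulTorsionFree A] [UniqueProds B] {r : MonoidAlgebra ℤ B}
    {v : B → A} (hv : (Function.mulSupport v).Finite)
    (h : (translationRep A B).asAlgebraHom r (.ofMul v) = 0) : r = 0 ∨ v = 1 := by
  by_contra! hne
  have hr : r.coeff.support.Nonempty :=
    Finsupp.support_nonempty_iff.2 fun h0 => hne.1 (MonoidAlgebra.coeff_injective h0)
  have hs : hv.toFinset.Nonempty := by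
    simpa [Function.mulSupport_nonempty_iff] using hne.2
  obtain ⟨b, hb, c, hc, hu⟩ := UniqueProds.uniqueMul_of_nonempty hr hs
  have h1 := translationRep_asAlgebraHom_apply r v (b * c)
  rw [h, Finset.prod_eq_single b, inv_mul_cancel_left] at h1
  · rw [Set.Finite.mem_toFinset, Function.mem_mulSupport] at hc
    rw [Finsupp.mem_support_iff] at hb
    exact (IsMulTorsionFree.zpow_eq_one_iff_left hb).not.2 hc h1.symm
  · intro b' hb' hbb'
    by_cases hc' : v (b'⁻¹ * (b * c)) = 1
    · rw [hc', one_zpow]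
    · exact absurd (hu hb' (by simpa using hc') (mul_inv_cancel_left _ _)).1 hbb'
  · exact fun hb' => absurd hb hb'

end Translation

section Wreath

variable {A B G : Type*} [CommGroup A] [Group B] [Group G]

/-- The projection of a wreath product onto its acting group. -/
def WreathProduct.proj (A B : Type*) [Group A] [Group B] : WreathProduct A B →* B :=
  RegularWreathProduct.rightHom.comp (WreathProduct A B).subtype

/-- If `G` embeds into `A ≀ B`, then the elements of `G` over `1 : B` form a principal factor, as
they embed into the module of finitely supported functions `B → A`. -/
theorem isPrincipalFactor_ker [IsMulTorsionFree A] [UniqueProds B] (Φ : G →* WreathProduct A B)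
    (hΦ : Function.Injective Φ) :
    IsPrincipalFactor ((WreathProduct.proj A B).comp Φ).ker ⊥ := by
  set π := (WreathProduct.proj A B).comp Φ
  have hright : ∀ x : π.ker, (Φ x).1.right = 1 := fun x => x.2
  let l : π.ker →* (B → A) :=
    { toFun := fun x => (Φ x).1.left
      map_one' := by simp
      map_mul' := fun x y => by
        ext b
        simp [hright x] }
  have hl : Function.Injective l := by
    rw [injective_iff_map_eq_one]
    intro x hx
    refine Subtype.ext ((injective_iff_map_eq_one Φ).1 hΦ x ?_)
    exact Subtype.ext (RegularWreathProduct.ext hx (hright x))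
  let k : Factor π.ker (⊥ : Subgroup G) →* (B → A) := QuotientGroup.lift _ l (by
    intro x hx
    have hx1 : x = 1 := Subtype.ext hx
    rw [hx1]; exact one_mem _)
  have hk : Function.Injective k := by
    rw [injective_iff_map_eq_one]
    intro x hx
    induction x using QuotientGroup.induction_on with
    | H x =>
      have hx1 : x = 1 := (injective_iff_map_eq_one l).1 hl x hx
      rw [hx1]; rfl
  have hab : IsMulCommutative (Factor π.ker (⊥ : Subgroup G)) :=
    isMulCommutative_factor_of_injective inferInstance k hk
  refine ⟨inferInstance, inferInstance, hab,
    FactorTorsionFree.of_injective hab (translationRep A B) (QuotientGroup.kerLift π)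
      (QuotientGroup.kerLift_injective π) k hk (fun g x => ?_) (fun r x h => ?_)⟩
  · change Additive.ofMul (Φ (g * x * g⁻¹)).1.left = translationRep A B (Φ g).1.right
      (.ofMul (Φ x).1.left)
    apply Additive.toMul.injective
    ext b
    rw [translationRep_apply]
    simp [hright x, mul_comm]
  · refine translationRep_eq_zero ?_ h
    induction x using QuotientGroup.induction_on with
    | H x => exact (Φ x).2

/-- A subgroup of `A ≀ B` that projects onto `B` is rigid, for `A` torsion-free abelian and `B`
rigid: its principal series consists of the preimages of the terms of a principal series of `B`,
with the trivial group added at the end unless the projection is injective. -/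
theorem IsRigid.of_injective_wreathProduct [IsMulTorsionFree A] (hB : IsRigid B)
    (Φ : G →* WreathProduct A B) (hΦ : Function.Injective Φ)
    (hsurj : Function.Surjective ((WreathProduct.proj A B).comp Φ)) : IsRigid G := by
  have := hB.uniqueProds
  have hker := isPrincipalFactor_ker Φ hΦ
  generalize (WreathProduct.proj A B).comp Φ = π at *
  obtain ⟨n, H, hH⟩ := hB
  have hlt : ∀ i : Fin n, (H i.succ).comap π < (H i.castSucc).comap π := fun i =>
    (Subgroup.comap_lt_comap_of_surjective hsurj).2 (hH.strictAnti i.castSucc_lt_succ)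
  have hfirst : (H 0).comap π = ⊤ := by rw [hH.first, Subgroup.comap_top]
  have hlast : (H (Fin.last n)).comap π = π.ker := by rw [hH.last, MonoidHom.comap_bot]
  by_cases hbot : π.ker = ⊥
  · exact ⟨n, fun i => (H i).comap π, .of_isPrincipalFactor hfirst (hlast.trans hbot) hlt
      fun i => (hH.isPrincipalFactor i).comap π⟩
  · let H' : Fin (n + 2) → Subgroup G := Fin.snoc (fun i => (H i).comap π) ⊥
    have hc : ∀ i : Fin (n + 1), H' i.castSucc = (H i).comap π := fun i => by simp [H']
    have hl : H' (Fin.last (n + 1)) = ⊥ := by simp [H']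
    refine ⟨n + 1, H', .of_isPrincipalFactor ((hc 0).trans hfirst) hl (fun i => ?_) fun i => ?_⟩
    all_goals
      cases i using Fin.lastCases with
      | last => ?_
      | cast i => ?_
    · rw [Fin.succ_last, hl, hc, hlast]
      exact bot_lt_iff_ne_bot.2 hbot
    · rw [Fin.succ_castSucc, hc, hc]
      exact hlt i
    · rw [Fin.succ_last, hl, hc, hlast]
      exact hker
    · rw [Fin.succ_castSucc, hc, hc]
      exact (hH.isPrincipalFactor i).comap π

theorem IsRigid.wreathProduct [IsMulTorsionFree A] (hB : IsRigid B) :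
    IsRigid (WreathProduct A B) :=
  hB.of_injective_wreathProduct (MonoidHom.id _) Function.injective_id fun b =>
    ⟨⟨RegularWreathProduct.inl b, by simp [WreathProduct]⟩, rfl⟩

end Wreath

/-! ### The Magnus embedding -/

section Magnus

variable {X : Type*} (R : Subgroup (FreeGroup X)) [R.Normal]

/-- The Magnus homomorphism of a free group `F` on `X` into the wreath product of the free abelian
group on `X` with `F / R`: a basis element `x` is sent to the pair of the function supported at `1`
with value `x`, and the class of `x`. -/
noncomputable def magnus :
    FreeGroup X →* WreathProduct (Multiplicative (X →₀ ℤ)) (FreeGroup X ⧸ R) :=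
  letI := Classical.decEq (FreeGroup X ⧸ R)
  FreeGroup.lift fun x =>
    ⟨⟨Pi.mulSingle 1 (.ofAdd (Finsupp.single x 1)), (FreeGroup.of x : FreeGroup X ⧸ R)⟩,
      (Set.finite_singleton 1).subset Pi.mulSupport_mulSingle_subset⟩

theorem proj_comp_magnus : (WreathProduct.proj _ _).comp (magnus R) = QuotientGroup.mk' R := by
  ext x
  simp [magnus, WreathProduct.proj]

theorem magnus_right (w : FreeGroup X) : (magnus R w).1.right = (w : FreeGroup X ⧸ R) :=
  DFunLike.congr_fun (proj_comp_magnus R) w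

/-- The generator of Schreier type `σ b * w * (σ (b * w))⁻¹` of `R`, where `σ` is the section
`Quotient.out` of the projection onto `F / R`. -/
noncomputable def schreier (b : FreeGroup X ⧸ R) (w : FreeGroup X) : R :=
  ⟨b.out * w * (b * (w : FreeGroup X ⧸ R)).out⁻¹, by
    rw [← QuotientGroup.eq_one_iff]
    simp⟩

theorem schreier_mul (b : FreeGroup X ⧸ R) (u w : FreeGroup X) :
    schreier R b (u * w) = schreier R b u * schreier R (b * u) w := by
  ext
  simp [schreier, mul_assoc]

/-- The homomorphism from the free abelian group on `X` to `R / [R, R]` that sends `x` to the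
class of `schreier R b x`. -/
noncomputable def schreierHom (b : FreeGroup X ⧸ R) :
    Multiplicative (X →₀ ℤ) →* Abelianization R :=
  AddMonoidHom.toMultiplicativeLeft (Finsupp.linearCombination ℤ fun x =>
    Additive.ofMul (Abelianization.of (schreier R b (FreeGroup.of x)))).toAddMonoidHom

theorem schreierHom_single (b : FreeGroup X ⧸ R) (x : X) :
    schreierHom R b (.ofAdd (Finsupp.single x 1)) =
      Abelianization.of (schreier R b (FreeGroup.of x)) := by
  simp [schreierHom]

/-- The class of `schreier R b w` in `R / [R, R]` can be read off from the Magnus image of `w`: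
the coordinates of `magnus R w` count the edges of the path labelled `w` in the Cayley graph of
`F / R`, and `schreier R b w` is the product of the Schreier generators along its translate that
starts at `b`. -/
theorem of_schreier_eq_finprod (w : FreeGroup X) (b : FreeGroup X ⧸ R) :
    Abelianization.of (schreier R b w) =
      ∏ᶠ c, schreierHom R (b * c) ((magnus R w).1.left c) := by
  have hfin : ∀ (f : FreeGroup X ⧸ R → Multiplicative (X →₀ ℤ)) (b : FreeGroup X ⧸ R),
      (Function.mulSupport f).Finite →
        (Function.mulSupport fun c => schreierHom R (b * c) (f c)).Finite := by
    intro f b hf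
    refine hf.subset fun c hc hfc => hc ?_
    simp [hfc]
  have hmul : ∀ u w b, ∏ᶠ c, schreierHom R (b * c) ((magnus R (u * w)).1.left c) =
      (∏ᶠ c, schreierHom R (b * c) ((magnus R u).1.left c)) *
        ∏ᶠ c, schreierHom R (b * u * c) ((magnus R w).1.left c) := by
    intro u w b
    have h2 : ∏ᶠ c, schreierHom R (b * u * c) ((magnus R w).1.left c) =
        ∏ᶠ c, schreierHom R (b * c) ((magnus R w).1.left ((u : FreeGroup X ⧸ R)⁻¹ * c)) := by
      refine Eq.trans ?_ (finprod_comp_equiv (Equiv.mulLeft (u : FreeGroup X ⧸ R)))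
      simp [mul_assoc]
    rw [h2, ← finprod_mul_distrib (hfin _ _ (magnus R u).2)]
    · refine finprod_congr fun c => ?_
      rw [map_mul, Subgroup.coe_mul, RegularWreathProduct.mul_left, Pi.mul_apply, map_mul,
        magnus_right]
    · exact hfin (fun c => (magnus R w).1.left ((u : FreeGroup X ⧸ R)⁻¹ * c)) b
        (Set.Finite.preimage (f := fun c => (u : FreeGroup X ⧸ R)⁻¹ * c)
          (mul_right_injective _).injOn (magnus R w).2)
  have hone : ∀ b, ∏ᶠ c, schreierHom R (b * c) ((magnus R 1).1.left c) = 1 := by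
    intro b
    simp
  have hsone : ∀ b, schreier R b 1 = 1 := by
    intro b
    ext
    simp [schreier]
  induction w using FreeGroup.induction_on generalizing b with
  | C1 => rw [hsone, map_one, hone]
  | of x =>
    let := Classical.decEq (FreeGroup X ⧸ R)
    rw [finprod_eq_single _ 1, mul_one, ← schreierHom_single]
    · simp [magnus]
    · intro c hc
      simp only [magnus, FreeGroup.lift_apply_of]
      rw [Pi.mulSingle_eq_of_ne hc, map_one]
  | inv_of x ih =>
    have h1 := hmul (FreeGroup.of x)⁻¹ (FreeGroup.of x) b
    have h2 := schreier_mul R b (FreeGroup.of x)⁻¹ (FreeGroup.of x)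
    rw [inv_mul_cancel, hone, ← ih] at h1
    rw [inv_mul_cancel, hsone] at h2
    have h3 := congrArg Abelianization.of h2
    rw [map_one, map_mul] at h3
    exact mul_right_cancel (h3.symm.trans h1)
  | mul u w hu hw => rw [schreier_mul, map_mul, hu, hw, hmul]

/-- The theorem of Magnus on the kernel of his embedding. -/
theorem ker_magnus : (magnus R).ker = ⁅R, R⁆ := by
  apply le_antisymm
  · intro w hw
    rw [MonoidHom.mem_ker] at hw
    have hwR : (w : FreeGroup X ⧸ R) = 1 := by rw [← magnus_right, hw]; rfl
    have h1 := of_schreier_eq_finprod R w 1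
    rw [hw] at h1
    have h2 : Abelianization.of (schreier R 1 w) = 1 := by simpa using h1
    have h3 : schreier R 1 w ∈ commutator R := by
      rw [← Abelianization.ker_of]; exact h2
    have h4 : ((schreier R 1 w : R) : FreeGroup X) ∈ ⁅R, R⁆ := by
      rw [← Subgroup.map_subtype_commutator]
      exact Subgroup.mem_map_of_mem R.subtype h3
    -- The representative `σ 1` need not be `1`, so `w` is obtained up to conjugation.
    have h5 : ((schreier R 1 w : R) : FreeGroup X) =
        (1 : FreeGroup X ⧸ R).out * w * (1 : FreeGroup X ⧸ R).out⁻¹ := by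
      simp [schreier, hwR]
    rw [h5] at h4
    rwa [mul_assoc, Subgroup.Normal.mem_comm_iff inferInstance, inv_mul_cancel_right] at h4
  · rw [Subgroup.commutator_le]
    intro u hu w hw
    have hu1 : (magnus R u).1.right = 1 := by
      rw [magnus_right]; exact (QuotientGroup.eq_one_iff u).2 hu
    have hw1 : (magnus R w).1.right = 1 := by
      rw [magnus_right]; exact (QuotientGroup.eq_one_iff w).2 hw
    rw [MonoidHom.mem_ker, map_commutatorElement, commutatorElement_eq_one_iff_mul_comm]
    refine Subtype.ext (RegularWreathProduct.ext ?_ ?_)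
    · ext1 c
      simp [hu1, hw1, mul_comm]
    · simp [hu1, hw1]

/-- Passing from `R` to `[R, R]` preserves rigidity of the quotient. -/
theorem IsRigid.quotient_commutator (h : IsRigid (FreeGroup X ⧸ R)) :
    IsRigid (FreeGroup X ⧸ ⁅R, R⁆) := by
  have hle : ⁅R, R⁆ ≤ (magnus R).ker := (ker_magnus R).ge
  refine h.of_injective_wreathProduct (QuotientGroup.lift ⁅R, R⁆ (magnus R) hle) ?_ ?_
  · rw [injective_iff_map_eq_one]
    intro w hw
    induction w using QuotientGroup.induction_on with
    | H w => exact (QuotientGroup.eq_one_iff w).2 ((ker_magnus R).le hw)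
  · intro b
    obtain ⟨w, rfl⟩ := QuotientGroup.mk_surjective b
    exact ⟨(w : FreeGroup X ⧸ ⁅R, R⁆), magnus_right R w⟩

end Magnus

theorem IsRigid.of_subsingleton (G : Type*) [Group G] [Subsingleton G] : IsRigid G :=
  ⟨0, fun _ => ⊤, .of_isPrincipalFactor rfl (Subsingleton.elim _ _) (fun i => i.elim0)
    fun i => i.elim0⟩

theorem isRigid_freeSolvableGroup (X : Type*) (c : ℕ) : IsRigid (FreeSolvableGroup X c) := by
  induction c with
  | zero =>
    have : Subsingleton (FreeSolvableGroup X 0) := QuotientGroup.subsingleton_quotient_top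
    exact .of_subsingleton _
  | succ c ih => exact ih.quotient_commutator

end RigidGroup

theorem mainTheorem3 :
    (∀ (X : Type*) (c : ℕ), RigidGroup.IsRigid (RigidGroup.FreeSolvableGroup X c)) ∧
    (∀ (A : Type*) (B : Type*) [CommGroup A] [Group B], IsMulTorsionFree A →
      RigidGroup.IsRigid B → RigidGroup.IsRigid (RigidGroup.WreathProduct A B)) :=
  ⟨RigidGroup.isRigid_freeSolvableGroup, fun _ _ _ _ _ hB => hB.wreathProduct⟩
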